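/- **Setting.** For each sample size $n$ let $X^n=(X_1,\dots,X_n)$ have true density $f_{0,n}$, and let $\{f_n(\cdot\mid\theta):\theta\in\Theta\}$, $\Theta\subseteq\mathbb{R}^p$, be a (possibly misspecified) parametric family of densities for $X^n$. Likelihoods and the prior density $\pi$ on $\Theta$ are extended by $0$ outside $\Theta$. Let $\theta^*$ be an interior point of $\Theta$, and suppose that the maximum likelihood estimator $\hat\theta_n=\arg\max_{\theta\in\Theta} f_n(X^n\mid\theta)$ is unique and that $\sqrt n(\hat\theta_n-\theta^*)$ is asymptotically normal under $f_{0,n}$. Fix $\alpha>0$ and suppose that the $\alpha$-posterior $$\pi_{n,\alpha}(\theta\mid X^n)=\frac{f_n(X^n\mid\theta)^\alpha\,\pi(\theta)}{\int f_n(X^n\mid\theta')^\alpha\,\pi(\theta')\,d\theta'}$$ is well defined, i.e. the denominator is almost surely positive and finite. A sequence $Y_n$ of functions of $X^n$ is *bounded in $f_{0,n}$-probability* if for every $\epsilon>0$ there is $C>0$ such that $\mathbb{P}_{f_{0,n}}(\|Y_n\|<C)\ge 1-\epsilon$ for all $n$. **Assumption 1 (stochastic LAN).** There is a positive definite matrix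 $V$ such that, with $\Delta_n=\sqrt n(\hat\theta_n-\theta^*)$, the residual $$R_n(h)=\log\frac{f_n(X^n\mid\theta^*+h/\sqrt n)}{f_n(X^n\mid\theta^*)}-h^\top V\Delta_n+\tfrac12 h^\top V h$$ satisfies $\sup_{h\in K}|R_n(h)|\to0$ in $f_{0,n}$-probability for every compact $K\subseteq\mathbb{R}^p$. **Assumption 2.** $\pi(\theta^*)>0$, and for every (data-dependent) sequence $(\mu_n,\Sigma_n)$, with $\mu_n\in\mathbb{R}^p$ and $\Sigma_n$ a diagonal positive definite $p\times p$ matrix, such that $(\sqrt n(\mu_n-\theta^*),n\Sigma_n)$ is bounded in $f_{0,n}$-probability, $$\int\phi\bigl(h\mid\sqrt n(\mu_n-\theta^*),n\Sigma_n\bigr)\log\frac{\pi(\theta^*+h/\sqrt n)}{\pi(\theta^*)}\,dh\to0,\qquad \int\phi\bigl(h\mid\sqrt n(\mu_n-\theta^*),n\Sigma_n\bigr)R_n(h)\,dh\to0$$ in $f_{0,n}$-probability, where $\phi(\cdot\mid m,S)$ is the density of $N(m,S)$. Here $\log 0=-\infty$, and it is part of the condition that, with probability tending to one, the integrals exist and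 are finite. **Theorem.** Let the Gaussian distribution $N(\tilde\mu_n,\tilde\Sigma_n)$ be a Gaussian mean-field variational approximation of the $\alpha$-posterior, i.e. a minimizer of the Kullback–Leibler divergence $\mathcal{K}(q\,\|\,\pi_{n,\alpha}(\cdot\mid X^n))$ over all Gaussian distributions $q=N(\mu,\Sigma)$ on $\mathbb{R}^p$ with $\Sigma$ diagonal and positive semi-definite. Suppose that $(\sqrt n(\tilde\mu_n-\theta^*),n\tilde\Sigma_n)$ is bounded in $f_{0,n}$-probability and that Assumptions 1 and 2 hold. Then $$d_{\mathrm{TV}}\Bigl(N(\tilde\mu_n,\tilde\Sigma_n),\;N\bigl(\hat\theta_n,\operatorname{diag}(V)^{-1}/(\alpha n)\bigr)\Bigr)\to0\quad\text{in } f_{0,n}\text{-probability},$$ where $d_{\mathrm{TV}}(p,q)=\tfrac12\int|p-q|$ and $V$ is the matrix of Assumption 1. -/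

import Mathlib

open MeasureTheory ProbabilityTheory InformationTheory Filter Topology Matrix
open scoped NNReal ENNReal

namespace AlphaVB

/-- `g` is a probability density with respect to the measure `m`. -/
structure IsProbDensity {X : Type*} [MeasurableSpace X] (m : Measure X) (g : X → ℝ) : Prop where
  measurable : Measurable g
  nonneg : ∀ x, 0 ≤ g x
  lintegral_eq_one : ∫⁻ x, ENNReal.ofReal (g x) ∂m = 1

/-- Sampling experiments, one for every sample size `n`: `𝒳 n` is the space of values of the
random vector `X^n`, `f₀ n` is the true density of `X^n`, the densities `f n θ` with `θ ∈ Θ` form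
the (possibly misspecified) parametric model, and `π` is the density of the prior on
`Θ ⊆ ℝ^p`, extended by zero outside `Θ`. The values of `f n θ` for `θ ∉ Θ` play no role. -/
structure Model (p : ℕ) (𝒳 : ℕ → Type*) [∀ n, MeasurableSpace (𝒳 n)] where
  /-- dominating measures -/
  ν : ∀ n, Measure (𝒳 n)
  sigmaFinite_ν : ∀ n, SigmaFinite (ν n)
  /-- true densities -/
  f₀ : ∀ n, 𝒳 n → ℝ
  isProbDensity_f₀ : ∀ n, IsProbDensity (ν n) (f₀ n)
  /-- parameter space -/
  Θ : Set (Fin p → ℝ)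
  measurableSet_Θ : MeasurableSet Θ
  /-- model densities -/
  f : ∀ n, (Fin p → ℝ) → 𝒳 n → ℝ
  isProbDensity_f : ∀ n, ∀ θ ∈ Θ, IsProbDensity (ν n) (f n θ)
  measurable_f : ∀ n, Measurable (fun z : (Fin p → ℝ) × 𝒳 n => f n z.1 z.2)
  /-- prior density -/
  π : (Fin p → ℝ) → ℝ
  isProbDensity_π : IsProbDensity volume π
  π_eq_zero : ∀ θ, θ ∉ Θ → π θ = 0

/-- The Gaussian distribution on `ℝ^p` with independent marginals, mean vector `μ` and (diagonal,
positive semi-definite) covariance matrix `diag(v)`. -/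
noncomputable def gaussianMF {p : ℕ} (μ : Fin p → ℝ) (v : Fin p → ℝ≥0) : Measure (Fin p → ℝ) :=
  Measure.pi fun i => gaussianReal (μ i) (v i)

/-- Total variation distance `(1/2) ∫ |dP/dm - dQ/dm| dm`, computed with the dominating measure
`m = P + Q`; see `tvDist_withDensity` for its value on measures with given densities. -/
noncomputable def tvDist {X : Type*} [MeasurableSpace X] (P Q : Measure X) : ℝ :=
  (1 / 2) * ∫ u, |(P.rnDeriv (P + Q) u).toReal - (Q.rnDeriv (P + Q) u).toReal| ∂(P + Q)

/-- For measures with densities `g` and `h` with respect to a common measure, `tvDist` is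
`(1/2) ∫ |g - h|`. -/
theorem tvDist_withDensity {X : Type*} [MeasurableSpace X] (m : Measure X) [SigmaFinite m]
    {g h : X → ℝ} (hg : IsProbDensity m g) (hh : IsProbDensity m h) :
    tvDist (m.withDensity fun u => ENNReal.ofReal (g u))
      (m.withDensity fun u => ENNReal.ofReal (h u)) = (1 / 2) * ∫ u, |g u - h u| ∂m := by
  set P := m.withDensity fun u => ENNReal.ofReal (g u) with hP
  set Q := m.withDensity fun u => ENNReal.ofReal (h u) with hQ
  have fP : IsFiniteMeasure P := isFiniteMeasure_withDensity (by simp [hg.lintegral_eq_one])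
  have fQ : IsFiniteMeasure Q := isFiniteMeasure_withDensity (by simp [hh.lintegral_eq_one])
  have aP : P ≪ m := withDensity_absolutelyContinuous _ _
  have aQ : Q ≪ m := withDensity_absolutelyContinuous _ _
  have aPQ : P + Q ≪ m := Measure.AbsolutelyContinuous.add_left_iff.2 ⟨aP, aQ⟩
  have aP' : P ≪ P + Q := Measure.AbsolutelyContinuous.rfl.add_right Q
  have aQ' : Q ≪ P + Q := by
    rw [add_comm]; exact Measure.AbsolutelyContinuous.rfl.add_right P
  have rP := Measure.rnDeriv_withDensity m hg.measurable.ennreal_ofReal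
  have rQ := Measure.rnDeriv_withDensity m hh.measurable.ennreal_ofReal
  have cP := Measure.rnDeriv_mul_rnDeriv (κ := m) aP'
  have cQ := Measure.rnDeriv_mul_rnDeriv (κ := m) aQ'
  unfold tvDist
  congr 1
  rw [← integral_rnDeriv_smul aPQ]
  refine integral_congr_ae ?_
  filter_upwards [rP, rQ, cP, cQ] with u h1 h2 h3 h4
  have e1 : g u = (P.rnDeriv (P + Q) u).toReal * ((P + Q).rnDeriv m u).toReal := by
    rw [← ENNReal.toReal_mul, ← Pi.mul_apply, h3, h1, ENNReal.toReal_ofReal (hg.nonneg u)]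
  have e2 : h u = (Q.rnDeriv (P + Q) u).toReal * ((P + Q).rnDeriv m u).toReal := by
    rw [← ENNReal.toReal_mul, ← Pi.mul_apply, h4, h2, ENNReal.toReal_ofReal (hh.nonneg u)]
  rw [e1, e2, ← sub_mul, abs_mul, abs_of_nonneg ENNReal.toReal_nonneg, smul_eq_mul, mul_comm]

section

variable {p : ℕ} {𝒳 : ℕ → Type*} [∀ n, MeasurableSpace (𝒳 n)]

namespace Model

/-- The true distribution of `X^n`. -/
noncomputable def P (M : Model p 𝒳) (n : ℕ) : Measure (𝒳 n) :=
  (M.ν n).withDensity fun x => ENNReal.ofReal (M.f₀ n x)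

instance isProbabilityMeasure_P (M : Model p 𝒳) (n : ℕ) : IsProbabilityMeasure (M.P n) :=
  ⟨by simp [P, (M.isProbDensity_f₀ n).lintegral_eq_one]⟩

/-- The likelihood `f_n(x | θ)`, extended by zero to `θ ∉ Θ`. -/
noncomputable def lik (M : Model p 𝒳) (n : ℕ) (x : 𝒳 n) : (Fin p → ℝ) → ℝ :=
  M.Θ.indicator fun θ => M.f n θ x

/-- The normalizing constant `∫ f_n(x | θ)^α π(θ) dθ` of the `α`-posterior. -/
noncomputable def evidence (M : Model p 𝒳) (α : ℝ) (n : ℕ) (x : 𝒳 n) : ℝ≥0∞ :=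
  ∫⁻ θ, ENNReal.ofReal (M.lik n x θ ^ α * M.π θ)

/-- The `α`-posterior given `X^n = x`. -/
noncomputable def alphaPosterior (M : Model p 𝒳) (α : ℝ) (n : ℕ) (x : 𝒳 n) :
    Measure (Fin p → ℝ) :=
  volume.withDensity fun θ => ENNReal.ofReal (M.lik n x θ ^ α * M.π θ) / M.evidence α n x

/-- `t` is the unique maximizer over `Θ` of the likelihood at the data point `x`. -/
def IsUniqueMLE (M : Model p 𝒳) (n : ℕ) (x : 𝒳 n) (t : Fin p → ℝ) : Prop :=
  t ∈ M.Θ ∧ ∀ θ ∈ M.Θ, θ ≠ t → M.f n θ x < M.f n t x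

/-- The estimators `θhat n` of `θstar` are asymptotically normal under the true distribution:
`√n (θhat n - θstar)` converges in distribution to a Gaussian law. -/
def AsymptoticallyNormal (M : Model p 𝒳) (θstar : Fin p → ℝ)
    (θhat : ∀ n, 𝒳 n → Fin p → ℝ) : Prop :=
  ∃ (G : Measure (Fin p → ℝ)) (_ : IsGaussian G),
    TendstoInDistribution (fun (n : ℕ) (x : 𝒳 n) => √(n : ℝ) • (θhat n x - θstar)) atTop
      id M.P G

/-- The residual `R_n(h)` of the quadratic expansion of the log-likelihood ratio at `θstar`. -/
noncomputable def residual (M : Model p 𝒳) (θstar : Fin p → ℝ) (θhat : ∀ n, 𝒳 n → Fin p → ℝ)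
    (V : Matrix (Fin p) (Fin p) ℝ) (n : ℕ) (x : 𝒳 n) (h : Fin p → ℝ) : ℝ :=
  Real.log (M.lik n x (θstar + (√(n : ℝ))⁻¹ • h) / M.lik n x θstar)
    - h ⬝ᵥ V *ᵥ (√(n : ℝ) • (θhat n x - θstar)) + (1 / 2) * (h ⬝ᵥ V *ᵥ h)

/-- Stochastic local asymptotic normality at `θstar` with matrix `V`: for every compact `K`,
`sup_{h ∈ K} |R_n(h)| → 0` in probability. The residual counts as infinite wherever one of the
two likelihoods in it vanishes. -/
def StochasticLAN (M : Model p 𝒳) (θstar : Fin p → ℝ) (θhat : ∀ n, 𝒳 n → Fin p → ℝ)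
    (V : Matrix (Fin p) (Fin p) ℝ) : Prop :=
  ∀ K : Set (Fin p → ℝ), IsCompact K → ∀ ε : ℝ, 0 < ε →
    Tendsto (fun n => M.P n {x | ¬ (0 < M.lik n x θstar ∧
      ∀ h ∈ K, 0 < M.lik n x (θstar + (√(n : ℝ))⁻¹ • h) ∧
        |M.residual θstar θhat V n x h| ≤ ε)}) atTop (𝓝 0)

/-- The sequence `Y n` of functions of the data is bounded in probability. -/
def BoundedInProb {E : Type*} [Norm E] (M : Model p 𝒳) (Y : ∀ n, 𝒳 n → E) : Prop :=
  ∀ ε : ℝ, 0 < ε → ∃ C : ℝ, 0 < C ∧ ∀ n, 1 - ε ≤ (M.P n).real {x | ‖Y n x‖ < C}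

/-- `(√n (μ_n - θstar), n Σ_n)`, with `Σ_n = diag(v n)`, is bounded in probability. -/
def RescaledBounded (M : Model p 𝒳) (θstar : Fin p → ℝ) (μ : ∀ n, 𝒳 n → Fin p → ℝ)
    (v : ∀ n, 𝒳 n → Fin p → ℝ≥0) : Prop :=
  M.BoundedInProb fun n x =>
    (√(n : ℝ) • (μ n x - θstar), fun i => (n : ℝ) * (v n x i : ℝ))

/-- Regularity of the prior and the residual along Gaussian distributions: for every data-dependent
sequence `(μ_n, Σ_n)`, with `Σ_n` diagonal and positive definite, such that
`(√n (μ_n - θstar), n Σ_n)` is bounded in probability, the integrals of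
`log (π(θstar + h/√n) / π(θstar))` and of `R_n(h)` against `N(√n (μ_n - θstar), n Σ_n)` tend to zero
in probability. The integrals are understood with the logarithm of `0` equal to `-∞`; that they
exist and are finite, with probability tending to one, is part of the condition. -/
def GaussianRegularity (M : Model p 𝒳) (θstar : Fin p → ℝ) (θhat : ∀ n, 𝒳 n → Fin p → ℝ)
    (V : Matrix (Fin p) (Fin p) ℝ) : Prop :=
  0 < M.π θstar ∧
  ∀ (μ : ∀ n, 𝒳 n → Fin p → ℝ) (v : ∀ n, 𝒳 n → Fin p → ℝ≥0),
    (∀ n, Measurable (μ n)) → (∀ n, Measurable (v n)) → (∀ n x i, 0 < v n x i) →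
    M.RescaledBounded θstar μ v →
    ∀ ε : ℝ, 0 < ε →
      Tendsto (fun n => M.P n {x | ¬
        ((∀ᵐ h ∂gaussianMF (√(n : ℝ) • (μ n x - θstar)) ((n : ℝ≥0) • v n x),
            0 < M.π (θstar + (√(n : ℝ))⁻¹ • h)) ∧
          Integrable (fun h => Real.log (M.π (θstar + (√(n : ℝ))⁻¹ • h) / M.π θstar))
            (gaussianMF (√(n : ℝ) • (μ n x - θstar)) ((n : ℝ≥0) • v n x)) ∧
          |∫ h, Real.log (M.π (θstar + (√(n : ℝ))⁻¹ • h) / M.π θstar)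
            ∂gaussianMF (√(n : ℝ) • (μ n x - θstar)) ((n : ℝ≥0) • v n x)| ≤ ε)})
        atTop (𝓝 0) ∧
      Tendsto (fun n => M.P n {x | ¬
        (0 < M.lik n x θstar ∧
          (∀ᵐ h ∂gaussianMF (√(n : ℝ) • (μ n x - θstar)) ((n : ℝ≥0) • v n x),
            0 < M.lik n x (θstar + (√(n : ℝ))⁻¹ • h)) ∧
          Integrable (M.residual θstar θhat V n x)
            (gaussianMF (√(n : ℝ) • (μ n x - θstar)) ((n : ℝ≥0) • v n x)) ∧
          |∫ h, M.residual θstar θhat V n x h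
            ∂gaussianMF (√(n : ℝ) • (μ n x - θstar)) ((n : ℝ≥0) • v n x)| ≤ ε)})
        atTop (𝓝 0)

/-- `N(m, diag(w))` is a Gaussian mean-field variational approximation of the `α`-posterior given
`X^n = x`: it minimizes the Kullback-Leibler divergence to the `α`-posterior over all Gaussian
distributions with independent marginals. -/
def IsGaussianMFApprox (M : Model p 𝒳) (α : ℝ) (n : ℕ) (x : 𝒳 n) (m : Fin p → ℝ)
    (w : Fin p → ℝ≥0) : Prop :=
  ∀ (m' : Fin p → ℝ) (w' : Fin p → ℝ≥0),
    klDiv (gaussianMF m w) (M.alphaPosterior α n x) ≤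
      klDiv (gaussianMF m' w') (M.alphaPosterior α n x)

end Model

end

end AlphaVB

/-! Put `m = √n (μ - θstar)` and `d = √n (θhat - θstar)`. Along Gaussians for which the log-prior
and the residual integrate to `o(1)`, the divergence from `N(μ, diag w)` to the `α`-posterior is, up
to `o(1)` and a constant free of `(μ, w)`, the negative entropy of the Gaussian plus `α/2 * ((m -
d)ᵀ V (m - d) + ∑ V i i * n * w i)` (`klDiv_alphaPosterior`). This is minimized exactly at `μ =
θhat`, `w i = 1 / (α n V i i)`, the claimed limit.

The variational optimum does at least as well as this target, so its excess in the limiting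
objective is `o(1)`. The excess is a variance part plus `α/2 * (m - d)ᵀ V (m - d)`. The divergence
from the optimum to the target Gaussian has the same variance part, with `diag V` replacing `V` in
the mean part. Since `diag V ≤ C V` (`exists_sum_diag_le_of_posDef`), that divergence is at most `C`
times the excess, and a Pinsker-type bound (`tvDist_gaussianMF_le`) turns it into total variation
(`tvDist_le_of_isGaussianMFApprox`).

In probability, the regularity assumption is applied both to the target, whose rescaled mean is
tight by asymptotic normality, and to the optimum. -/

namespace AlphaVB

/-! ### Mean-field Gaussians: density, moments, rescaling, degeneracy -/

section Gaussian

variable {p : ℕ}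

instance isProbabilityMeasure_gaussianMF (μ : Fin p → ℝ) (w : Fin p → ℝ≥0) :
    IsProbabilityMeasure (gaussianMF μ w) := by
  unfold gaussianMF; infer_instance

/-- The logarithm of the Lebesgue density of `gaussianMF μ w`, for positive variances. -/
noncomputable def logGauss (μ : Fin p → ℝ) (w : Fin p → ℝ≥0) (θ : Fin p → ℝ) : ℝ :=
  ∑ i, (-(1 / 2) * Real.log (2 * Real.pi * w i) - (θ i - μ i) ^ 2 / (2 * w i))

theorem measurable_logGauss (μ : Fin p → ℝ) (w : Fin p → ℝ≥0) : Measurable (logGauss μ w) := by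
  unfold logGauss; fun_prop

theorem exp_logGauss (μ : Fin p → ℝ) {w : Fin p → ℝ≥0} (hw : ∀ i, 0 < w i) (θ : Fin p → ℝ) :
    Real.exp (logGauss μ w θ) = ∏ i, gaussianPDFReal (μ i) (w i) (θ i) := by
  rw [logGauss, Real.exp_sum]
  refine Finset.prod_congr rfl fun i _ => ?_
  have h : 0 < 2 * Real.pi * (w i : ℝ) := by have := hw i; positivity
  rw [gaussianPDFReal_def, sub_eq_add_neg, Real.exp_add, neg_mul, Real.exp_neg, one_div_mul_eq_div,
    ← Real.log_sqrt h.le, Real.exp_log (Real.sqrt_pos.2 h)]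
  simp only [neg_div]

/-- A product measure is determined by its values on boxes; there the density times the indicator
factors over the coordinates, and Fubini applies. -/
theorem gaussianMF_eq_withDensity (μ : Fin p → ℝ) {w : Fin p → ℝ≥0} (hw : ∀ i, 0 < w i) :
    gaussianMF μ w = volume.withDensity fun θ => ENNReal.ofReal (Real.exp (logGauss μ w θ)) := by
  refine Measure.pi_eq (μ := fun i => gaussianReal (μ i) (w i)) fun s hs => ?_
  rw [withDensity_apply _ (MeasurableSet.univ_pi hs),
    ← lintegral_indicator (MeasurableSet.univ_pi hs)]
  have key : ∀ θ : Fin p → ℝ, (Set.univ.pi s).indicator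
      (fun θ => ENNReal.ofReal (Real.exp (logGauss μ w θ))) θ =
      ENNReal.ofReal (∏ i, (s i).indicator (gaussianPDFReal (μ i) (w i)) (θ i)) := by
    intro θ
    by_cases hθ : θ ∈ Set.univ.pi s
    · rw [Set.indicator_of_mem hθ, exp_logGauss μ hw]
      congr 1
      refine Finset.prod_congr rfl fun i _ => ?_
      rw [Set.indicator_of_mem (hθ i trivial)]
    · rw [Set.indicator_of_notMem hθ]
      simp only [Set.mem_pi, Set.mem_univ, true_implies, not_forall] at hθ
      obtain ⟨i, hi⟩ := hθ
      rw [Finset.prod_eq_zero (Finset.mem_univ i) (Set.indicator_of_notMem hi _)]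
      simp
  have hint : ∀ i, Integrable ((s i).indicator (gaussianPDFReal (μ i) (w i))) := fun i =>
    (integrable_gaussianPDFReal _ _).indicator (hs i)
  have hnn : ∀ i x, 0 ≤ (s i).indicator (gaussianPDFReal (μ i) (w i)) x := fun i x =>
    Set.indicator_nonneg (fun _ _ => gaussianPDFReal_nonneg _ _ _) _
  simp_rw [key]
  rw [← ofReal_integral_eq_lintegral_ofReal, integral_fintype_prod_volume_eq_prod (𝕜 := ℝ)
      (fun i => (s i).indicator (gaussianPDFReal (μ i) (w i))),
    ENNReal.ofReal_prod_of_nonneg fun i _ => integral_nonneg (hnn i)]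
  · refine Finset.prod_congr rfl fun i _ => ?_
    rw [gaussianReal_apply_eq_integral _ (hw i).ne', integral_indicator (hs i)]
  · exact Integrable.fintype_prod_dep (𝕜 := ℝ) (μ := fun _ => volume) hint
  · exact ae_of_all _ fun θ => Finset.prod_nonneg fun i _ => hnn i _

theorem isProbDensity_exp_logGauss (μ : Fin p → ℝ) {w : Fin p → ℝ≥0} (hw : ∀ i, 0 < w i) :
    IsProbDensity volume fun θ => Real.exp (logGauss μ w θ) where
  measurable := (measurable_logGauss μ w).exp
  nonneg _ := (Real.exp_pos _).le
  lintegral_eq_one := by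
    have h := measure_univ (μ := gaussianMF μ w)
    rwa [gaussianMF_eq_withDensity μ hw, withDensity_apply _ MeasurableSet.univ,
      Measure.restrict_univ] at h

theorem measurePreserving_eval_gaussianMF (μ : Fin p → ℝ) (w : Fin p → ℝ≥0) (i : Fin p) :
    MeasurePreserving (fun θ : Fin p → ℝ => θ i) (gaussianMF μ w) (gaussianReal (μ i) (w i)) :=
  measurePreserving_eval _ i

theorem memLp_eval_gaussianMF (μ : Fin p → ℝ) (w : Fin p → ℝ≥0) (i : Fin p) :
    MemLp (fun θ : Fin p → ℝ => θ i) 2 (gaussianMF μ w) :=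
  (memLp_id_gaussianReal' 2 (by simp)).comp_measurePreserving
    (measurePreserving_eval_gaussianMF μ w i)

theorem integrable_eval_gaussianMF (μ : Fin p → ℝ) (w : Fin p → ℝ≥0) (i : Fin p) :
    Integrable (fun θ : Fin p → ℝ => θ i) (gaussianMF μ w) :=
  (memLp_eval_gaussianMF μ w i).integrable (by norm_num)

theorem integrable_eval_mul_eval_gaussianMF (μ : Fin p → ℝ) (w : Fin p → ℝ≥0) (i j : Fin p) :
    Integrable (fun θ : Fin p → ℝ => θ i * θ j) (gaussianMF μ w) :=
  (memLp_eval_gaussianMF μ w i).integrable_mul (memLp_eval_gaussianMF μ w j)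

theorem integral_eval_gaussianMF (μ : Fin p → ℝ) (w : Fin p → ℝ≥0) (i : Fin p) :
    ∫ θ, θ i ∂gaussianMF μ w = μ i := by
  have h := (measurePreserving_eval_gaussianMF μ w i).map_eq
  rw [← integral_id_gaussianReal (μ := μ i) (v := w i), ← h,
    integral_map (f := fun x => x) (measurePreserving_eval_gaussianMF μ w i).aemeasurable aestronglyMeasurable_id]

theorem integral_eval_mul_eval_gaussianMF (μ : Fin p → ℝ) (w : Fin p → ℝ≥0) (i j : Fin p) :
    ∫ θ, θ i * θ j ∂gaussianMF μ w = μ i * μ j + if i = j then (w i : ℝ) else 0 := by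
  split_ifs with hij
  · subst hij
    have hv : Var[fun θ : Fin p → ℝ => θ i; gaussianMF μ w] = w i := by
      have h := (measurePreserving_eval_gaussianMF μ w i).map_eq
      rw [← variance_id_gaussianReal (μ := μ i) (v := w i), ← h,
        variance_map aemeasurable_id (measurePreserving_eval_gaussianMF μ w i).aemeasurable]
      rfl
    rw [variance_eq_sub (memLp_eval_gaussianMF μ w i), integral_eval_gaussianMF] at hv
    simp only [Pi.pow_apply] at hv
    simp_rw [← pow_two]
    linarith
  · have hind : IndepFun (fun θ : Fin p → ℝ => θ i) (fun θ => θ j) (gaussianMF μ w) :=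
      (iIndepFun_pi (μ := fun i => gaussianReal (μ i) (w i)) (X := fun _ x => x)
        fun i => aemeasurable_id).indepFun hij
    rw [hind.integral_fun_mul_eq_mul_integral (memLp_eval_gaussianMF μ w i).1
        (memLp_eval_gaussianMF μ w j).1,
      integral_eval_gaussianMF, integral_eval_gaussianMF, add_zero]

theorem integrable_sub_sq_gaussianMF (μ c : Fin p → ℝ) (w : Fin p → ℝ≥0) (i : Fin p) :
    Integrable (fun θ : Fin p → ℝ => (θ i - c i) ^ 2) (gaussianMF μ w) :=
  ((memLp_eval_gaussianMF μ w i).sub (memLp_const (c i))).integrable_sq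

theorem integral_sub_sq_gaussianMF (μ c : Fin p → ℝ) (w : Fin p → ℝ≥0) (i : Fin p) :
    ∫ θ, (θ i - c i) ^ 2 ∂gaussianMF μ w = w i + (μ i - c i) ^ 2 := by
  have h1 := integrable_eval_mul_eval_gaussianMF μ w i i
  have h2 := (integrable_eval_gaussianMF μ w i).const_mul (2 * c i)
  have e : ∀ θ : Fin p → ℝ, (θ i - c i) ^ 2 = θ i * θ i - 2 * c i * θ i + c i ^ 2 := fun θ => by
    ring
  have h3 : Integrable (fun θ : Fin p → ℝ => θ i * θ i - 2 * c i * θ i) (gaussianMF μ w) :=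
    h1.sub h2
  simp_rw [e]
  rw [integral_add h3 (integrable_const _), integral_sub h1 h2, integral_const_mul,
    integral_eval_mul_eval_gaussianMF, integral_eval_gaussianMF]
  simp
  ring

theorem integrable_logGauss (μ μ' : Fin p → ℝ) (w w' : Fin p → ℝ≥0) :
    Integrable (logGauss μ' w') (gaussianMF μ w) :=
  integrable_finsetSum _ fun i _ =>
    (integrable_const _).sub ((integrable_sub_sq_gaussianMF μ μ' w i).div_const _)

theorem integral_logGauss (μ μ' : Fin p → ℝ) (w w' : Fin p → ℝ≥0) :
    ∫ θ, logGauss μ' w' θ ∂gaussianMF μ w = ∑ i, (-(1 / 2) * Real.log (2 * Real.pi * w' i)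
      - (w i + (μ i - μ' i) ^ 2) / (2 * w' i)) := by
  have h : ∀ i, Integrable (fun θ : Fin p → ℝ => -(1 / 2) * Real.log (2 * Real.pi * w' i)
      - (θ i - μ' i) ^ 2 / (2 * w' i)) (gaussianMF μ w) := fun i =>
    (integrable_const _).sub ((integrable_sub_sq_gaussianMF μ μ' w i).div_const _)
  unfold logGauss
  rw [integral_finsetSum _ fun i _ => h i]
  refine Finset.sum_congr rfl fun i _ => ?_
  rw [integral_sub (integrable_const _) ((integrable_sub_sq_gaussianMF μ μ' w i).div_const _),
    integral_div, integral_sub_sq_gaussianMF]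
  simp

theorem integrable_dotProduct_gaussianMF (μ : Fin p → ℝ) (w : Fin p → ℝ≥0) (u : Fin p → ℝ) :
    Integrable (fun h : Fin p → ℝ => h ⬝ᵥ u) (gaussianMF μ w) :=
  integrable_finsetSum _ fun i _ => (integrable_eval_gaussianMF μ w i).mul_const _

theorem integral_dotProduct_gaussianMF (μ : Fin p → ℝ) (w : Fin p → ℝ≥0) (u : Fin p → ℝ) :
    ∫ h, h ⬝ᵥ u ∂gaussianMF μ w = μ ⬝ᵥ u := by
  unfold dotProduct
  rw [integral_finsetSum _ fun i _ => (integrable_eval_gaussianMF μ w i).mul_const _]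
  simp_rw [integral_mul_const, integral_eval_gaussianMF]

theorem dotProduct_mulVec_eq_sum (V : Matrix (Fin p) (Fin p) ℝ) (h : Fin p → ℝ) :
    h ⬝ᵥ V *ᵥ h = ∑ i, ∑ j, V i j * (h i * h j) := by
  simp only [dotProduct, mulVec, Finset.mul_sum]
  exact Finset.sum_congr rfl fun i _ => Finset.sum_congr rfl fun j _ => by ring

theorem integrable_quadratic_gaussianMF (μ : Fin p → ℝ) (w : Fin p → ℝ≥0)
    (V : Matrix (Fin p) (Fin p) ℝ) :
    Integrable (fun h : Fin p → ℝ => h ⬝ᵥ V *ᵥ h) (gaussianMF μ w) := by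
  simp_rw [dotProduct_mulVec_eq_sum]
  exact integrable_finsetSum _ fun i _ => integrable_finsetSum _ fun j _ =>
    (integrable_eval_mul_eval_gaussianMF μ w i j).const_mul _

theorem integral_quadratic_gaussianMF (μ : Fin p → ℝ) (w : Fin p → ℝ≥0)
    (V : Matrix (Fin p) (Fin p) ℝ) :
    ∫ h, h ⬝ᵥ V *ᵥ h ∂gaussianMF μ w = μ ⬝ᵥ V *ᵥ μ + ∑ i, V i i * w i := by
  have hi : ∀ i j, Integrable (fun h : Fin p → ℝ => V i j * (h i * h j)) (gaussianMF μ w) :=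
    fun i j => (integrable_eval_mul_eval_gaussianMF μ w i j).const_mul _
  simp_rw [dotProduct_mulVec_eq_sum]
  rw [integral_finsetSum _ fun i _ => integrable_finsetSum _ fun j _ => hi i j,
    ← Finset.sum_add_distrib]
  refine Finset.sum_congr rfl fun i _ => ?_
  rw [integral_finsetSum _ fun j _ => hi i j]
  simp_rw [integral_const_mul, integral_eval_mul_eval_gaussianMF, mul_add, mul_ite, mul_zero,
    Finset.sum_add_distrib]
  simp

/-- `gaussianMF μ w` is the image of its rescaling around `c` under `h ↦ c + r⁻¹ • h`. -/
theorem map_gaussianMF_rescale (μ c : Fin p → ℝ) (w : Fin p → ℝ≥0) {r : ℝ} (hr : r ≠ 0)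
    {k : ℝ≥0} (hk : (k : ℝ) = r ^ 2) :
    (gaussianMF (r • (μ - c)) (k • w)).map (fun h => c + r⁻¹ • h) = gaussianMF μ w := by
  have h := Measure.pi_map_pi (μ := fun i => gaussianReal ((r • (μ - c)) i) ((k • w) i))
    (f := fun i (x : ℝ) => c i + r⁻¹ * x) (fun i => by fun_prop)
  have e : (fun h : Fin p → ℝ => c + r⁻¹ • h) = fun h i => c i + r⁻¹ * h i := rfl
  rw [e, gaussianMF, h, gaussianMF]
  congr 1
  ext1 i
  have : (fun x : ℝ => c i + r⁻¹ * x) = (fun x => c i + x) ∘ fun x => r⁻¹ * x := rfl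
  rw [this, ← Measure.map_map (by fun_prop) (by fun_prop), gaussianReal_map_const_mul,
    gaussianReal_map_const_add]
  congr 1
  · simp only [Pi.smul_apply, Pi.sub_apply, smul_eq_mul]
    field_simp
    ring
  · ext
    simp only [Pi.smul_apply, smul_eq_mul, NNReal.coe_mul, NNReal.coe_mk, hk]
    field_simp

/-- A Gaussian distribution with a degenerate coordinate is not absolutely continuous. -/
theorem not_gaussianMF_absolutelyContinuous (μ : Fin p → ℝ) {w : Fin p → ℝ≥0} {i : Fin p}
    (hi : w i = 0) : ¬ gaussianMF μ w ≪ volume := by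
  intro h
  -- The hyperplane `θ i = μ i` is Lebesgue-null but carries all the mass of the degenerate
  -- Gaussian.
  have h0 : (volume : Measure (Fin p → ℝ)) ((fun θ => θ i) ⁻¹' {μ i}) = 0 :=
    (Measure.quasiMeasurePreserving_eval (μ := fun _ : Fin p => (volume : Measure ℝ)) i).preimage_null
      (by simp)
  have h1 := h h0
  rw [(measurePreserving_eval_gaussianMF μ w i).measure_preimage (by measurability), hi,
    gaussianReal_zero_var] at h1
  simp at h1

end Gaussian

/-! ### A Pinsker-type inequality and the Kullback-Leibler divergence of a Gaussian -/

/-- Pointwise source of Pinsker: with `s`, `t` two log-densities, the first term integrates to the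
divergence over `2 * δ` and the second to `2 * δ`. The proof passes through the Hellinger integrand
`(x - y) ^ 2`, where `x`, `y` are the square roots of the densities. -/
theorem abs_exp_sub_exp_le (s t : ℝ) {δ : ℝ} (hδ : 0 < δ) :
    |Real.exp s - Real.exp t| ≤ (Real.exp s * (s - t) - Real.exp s + Real.exp t) / (2 * δ)
      + δ * (Real.exp s + Real.exp t) := by
  set x := Real.exp (s / 2) with hx
  set y := Real.exp (t / 2) with hy
  have hx0 : 0 < x := Real.exp_pos _
  have hy0 : 0 < y := Real.exp_pos _
  have es : Real.exp s = x ^ 2 := by rw [hx, ← Real.exp_nat_mul]; congr 1; push_cast; ring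
  have et : Real.exp t = y ^ 2 := by rw [hy, ← Real.exp_nat_mul]; congr 1; push_cast; ring
  -- This is `1 + u ≤ exp u` at `u = (t - s) / 2`, multiplied by `2 * x ^ 2`.
  have h1 : x ^ 2 * (t - s) ≤ 2 * (x * y) - 2 * x ^ 2 := by
    have h := Real.add_one_le_exp (t / 2 - s / 2)
    rw [Real.exp_sub, ← hx, ← hy, le_div_iff₀ hx0] at h
    nlinarith [mul_le_mul_of_nonneg_left h hx0.le]
  have h2 : (x - y) ^ 2 ≤ x ^ 2 * (s - t) - x ^ 2 + y ^ 2 := by nlinarith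
  -- Weighted AM-GM for `|x - y| * (x + y)`; afterwards `(x + y) ^ 2 ≤ 2 * (x ^ 2 + y ^ 2)`.
  have h3 : |x ^ 2 - y ^ 2| ≤ (x - y) ^ 2 / (2 * δ) + δ * (x + y) ^ 2 / 2 := by
    rw [show x ^ 2 - y ^ 2 = (x - y) * (x + y) by ring, abs_mul, abs_of_pos (add_pos hx0 hy0),
      ← sq_abs (x - y)]
    have : (|x - y| ^ 2 / (2 * δ) + δ * (x + y) ^ 2 / 2) - |x - y| * (x + y)
        = (|x - y| - δ * (x + y)) ^ 2 / (2 * δ) := by field_simp; ring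
    have h4 : 0 ≤ (|x - y| - δ * (x + y)) ^ 2 / (2 * δ) := by positivity
    linarith
  rw [es, et]
  have h5 : (x - y) ^ 2 / (2 * δ) ≤ (x ^ 2 * (s - t) - x ^ 2 + y ^ 2) / (2 * δ) := by gcongr
  nlinarith [sq_nonneg (x - y)]

section

variable {p : ℕ}

theorem integrable_exp_logGauss_mul (μ : Fin p → ℝ) {w : Fin p → ℝ≥0} (hw : ∀ i, 0 < w i)
    {F : (Fin p → ℝ) → ℝ} (hF : Integrable F (gaussianMF μ w)) :
    Integrable fun θ => Real.exp (logGauss μ w θ) * F θ := by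
  have hm : Measurable fun θ => ENNReal.ofReal (Real.exp (logGauss μ w θ)) :=
    (measurable_logGauss μ w).exp.ennreal_ofReal
  rw [gaussianMF_eq_withDensity μ hw,
    integrable_withDensity_iff_integrable_smul' hm (ae_of_all _ fun _ => ENNReal.ofReal_lt_top)]
    at hF
  simpa only [ENNReal.toReal_ofReal (Real.exp_pos _).le, smul_eq_mul] using hF

theorem integral_exp_logGauss_mul (μ : Fin p → ℝ) {w : Fin p → ℝ≥0} (hw : ∀ i, 0 < w i)
    (F : (Fin p → ℝ) → ℝ) :
    ∫ θ, Real.exp (logGauss μ w θ) * F θ = ∫ θ, F θ ∂gaussianMF μ w := by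
  have hm : Measurable fun θ => ENNReal.ofReal (Real.exp (logGauss μ w θ)) :=
    (measurable_logGauss μ w).exp.ennreal_ofReal
  rw [gaussianMF_eq_withDensity μ hw,
    integral_withDensity_eq_integral_toReal_smul hm (ae_of_all _ fun _ => ENNReal.ofReal_lt_top)]
  simp only [ENNReal.toReal_ofReal (Real.exp_pos _).le, smul_eq_mul]

/-- A weak form of Pinsker's inequality for Gaussian distributions. -/
theorem tvDist_gaussianMF_le (μ μ' : Fin p → ℝ) {w w' : Fin p → ℝ≥0} (hw : ∀ i, 0 < w i)
    (hw' : ∀ i, 0 < w' i) {δ : ℝ} (hδ : 0 < δ) :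
    tvDist (gaussianMF μ w) (gaussianMF μ' w') ≤
      (∫ θ, (logGauss μ w θ - logGauss μ' w' θ) ∂gaussianMF μ w) / (4 * δ) + δ := by
  have hL : Integrable (fun θ => logGauss μ w θ - logGauss μ' w' θ) (gaussianMF μ w) :=
    (integrable_logGauss _ _ _ _).sub (integrable_logGauss _ _ _ _)
  have i0 := integrable_exp_logGauss_mul μ hw hL
  have i1 : Integrable fun θ => Real.exp (logGauss μ w θ) := by
    simpa using integrable_exp_logGauss_mul μ hw (integrable_const (1 : ℝ))
  have i2 : Integrable fun θ => Real.exp (logGauss μ' w' θ) := by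
    simpa using integrable_exp_logGauss_mul μ' hw' (integrable_const (1 : ℝ))
  have e1 : ∫ θ, Real.exp (logGauss μ w θ) = 1 := by
    simpa using integral_exp_logGauss_mul μ hw fun _ => 1
  have e2 : ∫ θ, Real.exp (logGauss μ' w' θ) = 1 := by
    simpa using integral_exp_logGauss_mul μ' hw' fun _ => 1
  have j1 : Integrable fun θ => (Real.exp (logGauss μ w θ) * (logGauss μ w θ - logGauss μ' w' θ)
      - Real.exp (logGauss μ w θ) + Real.exp (logGauss μ' w' θ)) / (2 * δ) :=
    ((i0.sub i1).add i2).div_const _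
  have j2 : Integrable fun θ => δ * (Real.exp (logGauss μ w θ) + Real.exp (logGauss μ' w' θ)) :=
    (i1.add i2).const_mul _
  have i3 : Integrable fun θ => Real.exp (logGauss μ w θ) * (logGauss μ w θ - logGauss μ' w' θ)
      - Real.exp (logGauss μ w θ) := i0.sub i1
  have h := integral_mono (i1.sub i2).abs (j1.add j2) fun θ =>
    abs_exp_sub_exp_le (logGauss μ w θ) (logGauss μ' w' θ) hδ
  simp only [Pi.sub_apply, Pi.add_apply] at h
  rw [integral_add j1 j2, integral_div, integral_add i3 i2, integral_sub i0 i1,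
    integral_const_mul, integral_add i1 i2, e1, e2, integral_exp_logGauss_mul μ hw] at h
  have hT := tvDist_withDensity volume (isProbDensity_exp_logGauss μ hw)
    (isProbDensity_exp_logGauss μ' hw')
  rw [← gaussianMF_eq_withDensity μ hw, ← gaussianMF_eq_withDensity μ' hw'] at hT
  rw [hT]
  refine (mul_le_mul_of_nonneg_left h (by norm_num)).trans_eq ?_
  field_simp
  ring

/-- The Kullback-Leibler divergence of a Gaussian distribution to a distribution whose density
is proportional to `g`. -/
theorem klDiv_gaussianMF_withDensity (μ : Fin p → ℝ) {w : Fin p → ℝ≥0} (hw : ∀ i, 0 < w i)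
    {g : (Fin p → ℝ) → ℝ} (hg : Measurable g)
    {Z : ℝ≥0∞} (hZ : ∫⁻ θ, ENNReal.ofReal (g θ) = Z) (hZ0 : Z ≠ 0) (hZt : Z ≠ ∞)
    (hpos : ∀ᵐ θ ∂gaussianMF μ w, 0 < g θ)
    (hint : Integrable (fun θ => Real.log (g θ)) (gaussianMF μ w)) :
    klDiv (gaussianMF μ w) (volume.withDensity fun θ => ENNReal.ofReal (g θ) / Z) ≠ ∞ ∧
      (klDiv (gaussianMF μ w) (volume.withDensity fun θ => ENNReal.ofReal (g θ) / Z)).toReal =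
        ∫ θ, logGauss μ w θ ∂gaussianMF μ w - ∫ θ, Real.log (g θ) ∂gaussianMF μ w
          + Real.log Z.toReal := by
  set q := gaussianMF μ w with hq
  set ν := (volume : Measure (Fin p → ℝ)).withDensity fun θ => ENNReal.ofReal (g θ) / Z with hν
  have hgm : Measurable fun θ => ENNReal.ofReal (g θ) / Z := hg.ennreal_ofReal.div_const _
  have hqd := gaussianMF_eq_withDensity μ hw
  have hqv : q ≪ volume := by rw [hq, hqd]; exact withDensity_absolutelyContinuous _ _
  have hνp : IsProbabilityMeasure ν := ⟨by
    rw [hν, withDensity_apply _ MeasurableSet.univ, Measure.restrict_univ]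
    simp_rw [div_eq_mul_inv]
    rw [lintegral_mul_const _ hg.ennreal_ofReal, hZ, ENNReal.mul_inv_cancel hZ0 hZt]⟩
  -- On a `ν`-null set `g ≤ 0` Lebesgue-a.e., hence `q`-a.e., which contradicts `hpos` unless the
  -- set is `q`-null.
  have hac : q ≪ ν := by
    refine Measure.AbsolutelyContinuous.mk fun s hs h0 => ?_
    rw [hν, withDensity_apply _ hs, lintegral_eq_zero_iff hgm, EventuallyEq,
      ae_restrict_iff' hs] at h0
    have h1 := hqv.ae_le h0
    rw [← nonpos_iff_eq_zero, ← measure_empty (μ := q)]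
    refine measure_mono_ae ?_
    filter_upwards [h1, hpos] with θ h2 h3 hθ
    have h4 := h2 hθ
    simp only [Pi.zero_apply, ENNReal.div_eq_zero_iff, hZt, or_false, ENNReal.ofReal_eq_zero] at h4
    linarith
  have hllr : llr q ν =ᵐ[q] fun θ => logGauss μ w θ - Real.log (g θ) + Real.log Z.toReal := by
    have r1 := hqv.ae_le (Measure.rnDeriv_mul_rnDeriv (κ := volume) hac)
    have r2 : q.rnDeriv volume =ᵐ[q] fun θ => ENNReal.ofReal (Real.exp (logGauss μ w θ)) := by
      refine hqv.ae_le ?_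
      rw [hq, hqd]
      exact Measure.rnDeriv_withDensity _ (measurable_logGauss μ w).exp.ennreal_ofReal
    have r3 := hqv.ae_le (Measure.rnDeriv_withDensity volume hgm)
    filter_upwards [r1, r2, r3, hpos] with θ h1 h2 h3 h4
    rw [Pi.mul_apply, h2, h3] at h1
    have h5 := congrArg ENNReal.toReal h1
    rw [ENNReal.toReal_mul, ENNReal.toReal_div, ENNReal.toReal_ofReal h4.le,
      ENNReal.toReal_ofReal (Real.exp_pos _).le] at h5
    have hz : 0 < Z.toReal := ENNReal.toReal_pos hZ0 hZt
    have h6 : (q.rnDeriv ν θ).toReal = Real.exp (logGauss μ w θ) / g θ * Z.toReal := by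
      rw [← h5]; field_simp
    rw [llr, h6, Real.log_mul (by positivity) hz.ne', Real.log_div (by positivity) h4.ne',
      Real.log_exp]
  have hL := integrable_logGauss μ μ w w
  have hi : Integrable (llr q ν) q :=
    (integrable_congr hllr).2 ((hL.sub hint).add (integrable_const _))
  refine ⟨klDiv_ne_top hac hi, ?_⟩
  have hs : Integrable (fun θ => logGauss μ w θ - Real.log (g θ)) q := hL.sub hint
  rw [toReal_klDiv_of_measure_eq hac (by simp), integral_congr_ae hllr,
    integral_add hs (integrable_const _), integral_sub hL hint, integral_const, probReal_univ,
    one_smul]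

end

/-! ### The variational objective in local coordinates -/

section

variable {p : ℕ} {𝒳 : ℕ → Type*} [∀ n, MeasurableSpace (𝒳 n)]

namespace Model

variable (M : Model p 𝒳) (θstar : Fin p → ℝ) (θhat : ∀ n, 𝒳 n → Fin p → ℝ)
  (V : Matrix (Fin p) (Fin p) ℝ)

/-- At the data point `x`, the log-prior integrates to at most `η` along the rescaled
`N(μ, diag(v))`. -/
def PriorRegularAt (n : ℕ) (μ : Fin p → ℝ) (v : Fin p → ℝ≥0) (η : ℝ) : Prop :=
  (∀ᵐ h ∂gaussianMF (√(n : ℝ) • (μ - θstar)) ((n : ℝ≥0) • v),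
      0 < M.π (θstar + (√(n : ℝ))⁻¹ • h)) ∧
    Integrable (fun h => Real.log (M.π (θstar + (√(n : ℝ))⁻¹ • h) / M.π θstar))
      (gaussianMF (√(n : ℝ) • (μ - θstar)) ((n : ℝ≥0) • v)) ∧
    |∫ h, Real.log (M.π (θstar + (√(n : ℝ))⁻¹ • h) / M.π θstar)
      ∂gaussianMF (√(n : ℝ) • (μ - θstar)) ((n : ℝ≥0) • v)| ≤ η

/-- At the data point `x`, the residual integrates to at most `η` along the rescaled
`N(μ, diag(v))`. -/
def ResidualRegularAt (n : ℕ) (x : 𝒳 n) (μ : Fin p → ℝ) (v : Fin p → ℝ≥0) (η : ℝ) : Prop :=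
  0 < M.lik n x θstar ∧
    (∀ᵐ h ∂gaussianMF (√(n : ℝ) • (μ - θstar)) ((n : ℝ≥0) • v),
      0 < M.lik n x (θstar + (√(n : ℝ))⁻¹ • h)) ∧
    Integrable (M.residual θstar θhat V n x)
      (gaussianMF (√(n : ℝ) • (μ - θstar)) ((n : ℝ≥0) • v)) ∧
    |∫ h, M.residual θstar θhat V n x h
      ∂gaussianMF (√(n : ℝ) • (μ - θstar)) ((n : ℝ≥0) • v)| ≤ η

theorem measurable_lik (n : ℕ) (x : 𝒳 n) : Measurable (M.lik n x) :=
  ((M.measurable_f n).comp measurable_prodMk_right).indicator M.measurableSet_Θ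

variable {M θstar θhat V}

/-- The definition of the residual, solved for the log-likelihood. The last bracket does not depend
on `h`, so it cancels when two Gaussians are compared. -/
theorem log_alphaPosterior_density {α : ℝ} {n : ℕ} {x : 𝒳 n} (hπ : 0 < M.π θstar)
    (hl : 0 < M.lik n x θstar) {h : Fin p → ℝ} (hπh : 0 < M.π (θstar + (√(n : ℝ))⁻¹ • h))
    (hlh : 0 < M.lik n x (θstar + (√(n : ℝ))⁻¹ • h)) :
    Real.log (M.lik n x (θstar + (√(n : ℝ))⁻¹ • h) ^ α * M.π (θstar + (√(n : ℝ))⁻¹ • h)) =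
      α * M.residual θstar θhat V n x h
        + α * (h ⬝ᵥ V *ᵥ (√(n : ℝ) • (θhat n x - θstar))) - α / 2 * (h ⬝ᵥ V *ᵥ h)
        + Real.log (M.π (θstar + (√(n : ℝ))⁻¹ • h) / M.π θstar)
        + (α * Real.log (M.lik n x θstar) + Real.log (M.π θstar)) := by
  rw [Real.log_mul (Real.rpow_pos_of_pos hlh _).ne' hπh.ne', Real.log_rpow hlh, residual,
    Real.log_div hlh.ne' hl.ne', Real.log_div hπh.ne' hπ.ne']
  ring

/-- The variational objective at a Gaussian distribution along which prior and residual are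
regular: up to a small error, it is a quadratic function of the mean and variances. -/
theorem klDiv_alphaPosterior {α : ℝ} (hα : 0 < α) {n : ℕ} (hn : n ≠ 0) {x : 𝒳 n}
    (hZ0 : M.evidence α n x ≠ 0) (hZt : M.evidence α n x ≠ ∞) (hπ : 0 < M.π θstar)
    {μ : Fin p → ℝ} {w : Fin p → ℝ≥0} (hw : ∀ i, 0 < w i) {η : ℝ}
    (hP : M.PriorRegularAt θstar n μ w η) (hR : M.ResidualRegularAt θstar θhat V n x μ w η) :
    klDiv (gaussianMF μ w) (M.alphaPosterior α n x) ≠ ∞ ∧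
      |(klDiv (gaussianMF μ w) (M.alphaPosterior α n x)).toReal
        - (∫ θ, logGauss μ w θ ∂gaussianMF μ w
          - α * ((√(n : ℝ) • (μ - θstar)) ⬝ᵥ V *ᵥ (√(n : ℝ) • (θhat n x - θstar)))
          + α / 2 * ((√(n : ℝ) • (μ - θstar)) ⬝ᵥ V *ᵥ (√(n : ℝ) • (μ - θstar))
            + ∑ i, V i i * (n * w i))
          + (Real.log (M.evidence α n x).toReal - α * Real.log (M.lik n x θstar)
            - Real.log (M.π θstar)))| ≤ (α + 1) * η := by
  obtain ⟨hP1, hP2, hP3⟩ := hP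
  obtain ⟨hl, hR1, hR2, hR3⟩ := hR
  set qh := gaussianMF (√(n : ℝ) • (μ - θstar)) ((n : ℝ≥0) • w) with hqh
  set Δ := √(n : ℝ) • (θhat n x - θstar) with hΔ
  have hn' : (0 : ℝ) < n := by positivity
  have hmap : qh.map (fun h => θstar + (√(n : ℝ))⁻¹ • h) = gaussianMF μ w :=
    map_gaussianMF_rescale μ θstar w (Real.sqrt_pos.2 hn').ne'
      (by rw [Real.sq_sqrt hn'.le]; simp)
  have hmeas : Measurable fun h : Fin p → ℝ => θstar + (√(n : ℝ))⁻¹ • h := by fun_prop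
  have hgm : Measurable fun θ => M.lik n x θ ^ α * M.π θ :=
    ((M.measurable_lik n x).pow_const α).mul M.isProbDensity_π.measurable
  have hlog : ∀ᵐ h ∂qh, Real.log (M.lik n x (θstar + (√(n : ℝ))⁻¹ • h) ^ α
      * M.π (θstar + (√(n : ℝ))⁻¹ • h)) = α * M.residual θstar θhat V n x h
        + α * (h ⬝ᵥ V *ᵥ Δ) - α / 2 * (h ⬝ᵥ V *ᵥ h)
        + Real.log (M.π (θstar + (√(n : ℝ))⁻¹ • h) / M.π θstar)
        + (α * Real.log (M.lik n x θstar) + Real.log (M.π θstar)) := by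
    filter_upwards [hP1, hR1] with h h1 h2
    exact log_alphaPosterior_density hπ hl h1 h2
  have a1 : Integrable (fun h => α * M.residual θstar θhat V n x h) qh := hR2.const_mul α
  have a2 : Integrable (fun h : Fin p → ℝ => α * (h ⬝ᵥ V *ᵥ Δ)) qh :=
    (integrable_dotProduct_gaussianMF _ _ _).const_mul α
  have a3 : Integrable (fun h : Fin p → ℝ => α / 2 * (h ⬝ᵥ V *ᵥ h)) qh :=
    (integrable_quadratic_gaussianMF _ _ _).const_mul (α / 2)
  have a12 := a1.add a2
  have a123 := a12.sub a3
  have a1234 := a123.add hP2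
  have aint := a1234.add
    (integrable_const (α * Real.log (M.lik n x θstar) + Real.log (M.π θstar)))
  have hlogm : Measurable fun θ => Real.log (M.lik n x θ ^ α * M.π θ) := hgm.log
  have hint : Integrable (fun θ => Real.log (M.lik n x θ ^ α * M.π θ)) (gaussianMF μ w) := by
    rw [← hmap, integrable_map_measure hlogm.aestronglyMeasurable hmeas.aemeasurable]
    exact (integrable_congr hlog).2 aint
  have hpos : ∀ᵐ θ ∂gaussianMF μ w, 0 < M.lik n x θ ^ α * M.π θ := by
    rw [← hmap, ae_map_iff hmeas.aemeasurable (measurableSet_lt measurable_const hgm)]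
    filter_upwards [hP1, hR1] with h h1 h2
    exact mul_pos (Real.rpow_pos_of_pos h2 _) h1
  have hI : ∫ θ, Real.log (M.lik n x θ ^ α * M.π θ) ∂gaussianMF μ w =
      α * ∫ h, M.residual θstar θhat V n x h ∂qh
        + α * ((√(n : ℝ) • (μ - θstar)) ⬝ᵥ V *ᵥ Δ)
        - α / 2 * ((√(n : ℝ) • (μ - θstar)) ⬝ᵥ V *ᵥ (√(n : ℝ) • (μ - θstar))
            + ∑ i, V i i * (n * w i))
        + ∫ h, Real.log (M.π (θstar + (√(n : ℝ))⁻¹ • h) / M.π θstar) ∂qh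
        + (α * Real.log (M.lik n x θstar) + Real.log (M.π θstar)) := by
    rw [← hmap, integral_map hmeas.aemeasurable hlogm.aestronglyMeasurable, integral_congr_ae hlog]
    have e1 := integral_add a1234
      (integrable_const (α * Real.log (M.lik n x θstar) + Real.log (M.π θstar)))
    have e2 := integral_add a123 hP2
    have e3 := integral_sub a12 a3
    have e4 := integral_add a1 a2
    have e5 := integral_dotProduct_gaussianMF (√(n : ℝ) • (μ - θstar)) ((n : ℝ≥0) • w) (V *ᵥ Δ)
    have e6 := integral_quadratic_gaussianMF (√(n : ℝ) • (μ - θstar)) ((n : ℝ≥0) • w) V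
    simp only [Pi.add_apply, Pi.sub_apply, integral_const_mul, integral_const, probReal_univ,
      one_mul, ← hqh, Pi.smul_apply, smul_eq_mul, NNReal.coe_mul, NNReal.coe_natCast]
      at e1 e2 e3 e4 e5 e6
    rw [e1, e2, e3, e4, e5, e6]
  obtain ⟨hne, hkl⟩ := klDiv_gaussianMF_withDensity μ hw hgm rfl hZ0 hZt hpos hint
  refine ⟨hne, ?_⟩
  have hkl' : (klDiv (gaussianMF μ w) (M.alphaPosterior α n x)).toReal = _ := hkl
  have hZe : (∫⁻ θ, ENNReal.ofReal (M.lik n x θ ^ α * M.π θ)) = M.evidence α n x := rfl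
  rw [hkl', hI, hZe]
  have h1 := abs_le.1 hP3
  have h2 := abs_le.1 hR3
  have h3 := mul_le_mul_of_nonneg_left h2.1 hα.le
  have h4 := mul_le_mul_of_nonneg_left h2.2 hα.le
  rw [abs_le]
  constructor <;> linarith [h1.1, h1.2]

/-- A degenerate Gaussian distribution has infinite divergence to the `α`-posterior. -/
theorem klDiv_alphaPosterior_eq_top {α : ℝ} {n : ℕ} {x : 𝒳 n} {μ : Fin p → ℝ} {w : Fin p → ℝ≥0}
    {i : Fin p} (hi : w i = 0) : klDiv (gaussianMF μ w) (M.alphaPosterior α n x) = ∞ :=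
  klDiv_of_not_ac fun h => not_gaussianMF_absolutelyContinuous μ hi
    (h.trans (withDensity_absolutelyContinuous _ _))

end Model

end

/-! ### From near-optimality to total variation -/

section

variable {p : ℕ} {𝒳 : ℕ → Type*} [∀ n, MeasurableSpace (𝒳 n)]

/-- A positive definite quadratic form dominates its diagonal part. -/
theorem exists_sum_diag_le_of_posDef {V : Matrix (Fin p) (Fin p) ℝ} (hV : V.PosDef) :
    ∃ C : ℝ, 1 ≤ C ∧ ∀ u : Fin p → ℝ, ∑ i, V i i * u i ^ 2 ≤ C * (u ⬝ᵥ V *ᵥ u) := by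
  have hpos : ∀ u : Fin p → ℝ, u ≠ 0 → 0 < u ⬝ᵥ V *ᵥ u := fun u hu => by
    simpa using hV.dotProduct_mulVec_pos hu
  -- A positive lower bound on the unit sphere, available also for `p = 0`, when the sphere is
  -- empty.
  obtain ⟨c, hc, hmin⟩ := (isCompact_sphere (0 : Fin p → ℝ) 1).exists_forall_le'
    (f := fun u => u ⬝ᵥ V *ᵥ u) (a := 0)
    (Continuous.continuousOn (by simp only [dotProduct_mulVec_eq_sum]; fun_prop))
    fun u hu => hpos u fun h => by simp [h] at hu
  have hS : 0 ≤ ∑ i, V i i := Finset.sum_nonneg fun i _ => hV.diag_pos.le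
  refine ⟨max 1 ((∑ i, V i i) / c), le_max_left _ _, fun u => ?_⟩
  by_cases hu : u = 0
  · simp [hu]
  have hun : 0 < ‖u‖ := norm_pos_iff.2 hu
  have h1 : c * ‖u‖ ^ 2 ≤ u ⬝ᵥ V *ᵥ u := by
    have h := hmin (‖u‖⁻¹ • u) (by simp [norm_smul, hun.ne'])
    simp only [mulVec_smul, dotProduct_smul, smul_dotProduct, smul_eq_mul] at h
    calc c * ‖u‖ ^ 2 ≤ (‖u‖⁻¹ * (‖u‖⁻¹ * (u ⬝ᵥ V *ᵥ u))) * ‖u‖ ^ 2 := by gcongr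
      _ = u ⬝ᵥ V *ᵥ u := by field_simp
  have h2 : ∑ i, V i i * u i ^ 2 ≤ (∑ i, V i i) * ‖u‖ ^ 2 := by
    rw [Finset.sum_mul]
    refine Finset.sum_le_sum fun i _ => mul_le_mul_of_nonneg_left ?_ hV.diag_pos.le
    rw [← sq_abs, ← Real.norm_eq_abs]
    gcongr
    exact norm_le_pi_norm u i
  calc ∑ i, V i i * u i ^ 2 ≤ (∑ i, V i i) / c * (c * ‖u‖ ^ 2) := by
        rw [← mul_assoc, div_mul_cancel₀ _ hc.ne']; exact h2
    _ ≤ (∑ i, V i i) / c * (u ⬝ᵥ V *ᵥ u) := by gcongr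
    _ ≤ _ := by
        have := (hpos u hu).le
        gcongr
        exact le_max_right _ _

theorem quadratic_sub {V : Matrix (Fin p) (Fin p) ℝ} (hV : V.PosDef) (m d : Fin p → ℝ) :
    (m - d) ⬝ᵥ V *ᵥ (m - d) = m ⬝ᵥ V *ᵥ m - 2 * (m ⬝ᵥ V *ᵥ d) + d ⬝ᵥ V *ᵥ d := by
  have hT : Vᵀ = V := by simpa using hV.isHermitian.eq
  have hs : d ⬝ᵥ V *ᵥ m = m ⬝ᵥ V *ᵥ d := by
    rw [dotProduct_mulVec, ← mulVec_transpose, hT, dotProduct_comm]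
  rw [mulVec_sub, sub_dotProduct, dotProduct_sub, dotProduct_sub, hs]
  ring

namespace Model

variable {M : Model p 𝒳} {θstar : Fin p → ℝ} {θhat : ∀ n, 𝒳 n → Fin p → ℝ}
  {V : Matrix (Fin p) (Fin p) ℝ}

/-- The deterministic core, at one data point. Each of the two objectives is known up to `(α + 1) *
η`, whence the factor `2`. Regularity along `N(μ, diag w)` is asked for only when `w` is positive,
since positivity follows from minimality. -/
theorem tvDist_le_of_isGaussianMFApprox {α : ℝ} (hα : 0 < α) (hV : V.PosDef) {C : ℝ} (hC : 1 ≤ C)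
    (hVC : ∀ u : Fin p → ℝ, ∑ i, V i i * u i ^ 2 ≤ C * (u ⬝ᵥ V *ᵥ u))
    {n : ℕ} (hn : n ≠ 0) {x : 𝒳 n}
    (hZ0 : M.evidence α n x ≠ 0) (hZt : M.evidence α n x ≠ ∞) (hπ : 0 < M.π θstar)
    {μ : Fin p → ℝ} {w w' : Fin p → ℝ≥0} (hw' : ∀ i, (w' i : ℝ) = (V i i)⁻¹ / (α * n))
    (hmin : M.IsGaussianMFApprox α n x μ w) {η : ℝ}
    (hP' : M.PriorRegularAt θstar n (θhat n x) w' η)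
    (hR' : M.ResidualRegularAt θstar θhat V n x (θhat n x) w' η)
    (hP : (∀ i, 0 < w i) → M.PriorRegularAt θstar n μ w η)
    (hR : (∀ i, 0 < w i) → M.ResidualRegularAt θstar θhat V n x μ w η) {δ : ℝ} (hδ : 0 < δ) :
    tvDist (gaussianMF μ w) (gaussianMF (θhat n x) w') ≤
      C * (2 * (α + 1) * η) / (4 * δ) + δ := by
  have hn' : (0 : ℝ) < n := by positivity
  have hVi : ∀ i, 0 < V i i := fun i => hV.diag_pos
  have hw'0 : ∀ i, 0 < w' i := fun i => by
    rw [← NNReal.coe_pos, hw']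
    have := hVi i
    positivity
  obtain ⟨hne', hkl'⟩ := klDiv_alphaPosterior hα hn hZ0 hZt hπ hw'0 hP' hR'
  have hle := hmin (θhat n x) w'
  -- A degenerate minimizer would have infinite divergence, while the competitor has a finite one.
  have hw : ∀ i, 0 < w i := fun i => by
    by_contra hi
    rw [klDiv_alphaPosterior_eq_top (i := i) (by simpa using hi), top_le_iff] at hle
    exact hne' hle
  obtain ⟨hne, hkl⟩ := klDiv_alphaPosterior hα hn hZ0 hZt hπ hw (hP hw) (hR hw)
  have hle' := ENNReal.toReal_mono hne' hle
  refine (tvDist_gaussianMF_le μ (θhat n x) hw hw'0 hδ).trans ?_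
  gcongr
  rw [integral_logGauss] at hkl hkl'
  rw [integral_sub (integrable_logGauss _ _ _ _) (integrable_logGauss _ _ _ _), integral_logGauss,
    integral_logGauss]
  set m := √(n : ℝ) • (μ - θstar) with hm
  set d := √(n : ℝ) • (θhat n x - θstar) with hd
  have hq := quadratic_sub hV m d
  have hdiff : ∀ i, (m - d) i ^ 2 = n * (μ i - θhat n x i) ^ 2 := fun i => by
    simp only [hm, hd, Pi.sub_apply, Pi.smul_apply, smul_eq_mul, ← mul_sub, mul_pow,
      Real.sq_sqrt hn'.le]
    ring
  have hu := hVC (m - d)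
  have hu0 : 0 ≤ (m - d) ⬝ᵥ V *ᵥ (m - d) := by
    simpa using hV.posSemidef.dotProduct_mulVec_nonneg (m - d)
  set L : Fin p → ℝ := fun i => -(1 / 2) * Real.log (2 * Real.pi * w i)
  set L' : Fin p → ℝ := fun i => -(1 / 2) * Real.log (2 * Real.pi * w' i)
  -- The divergence between one-dimensional Gaussians with equal means: `log r ≤ r - 1` at the
  -- variance ratio `r = w i / w' i`.
  have hterm : ∀ i, 0 ≤ L i - L' i - 1 / 2 + α / 2 * (V i i * (n * w i)) := fun i => by
    have h0 : (0 : ℝ) < w i := hw i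
    have h0' : (0 : ℝ) < w' i := hw'0 i
    have hlog := Real.log_le_sub_one_of_pos (div_pos h0 h0')
    have e : (w i : ℝ) / w' i = α * (V i i * (n * w i)) := by
      rw [hw']
      have := (hVi i).ne'
      field_simp
    rw [Real.log_div h0.ne' h0'.ne', e] at hlog
    simp only [L, L']
    rw [Real.log_mul (by positivity) h0.ne', Real.log_mul (by positivity) h0'.ne']
    linarith
  have hG := Finset.sum_nonneg fun i (_ : i ∈ Finset.univ) => hterm i
  have s1 : ∑ i, (L i - (w i + (μ i - μ i) ^ 2) / (2 * w i)) = ∑ i, (L i - 1 / 2) := by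
    refine Finset.sum_congr rfl fun i _ => ?_
    have : (w i : ℝ) ≠ 0 := (NNReal.coe_pos.2 (hw i)).ne'
    field_simp
    ring
  have s2 : ∑ i, (L' i - (w' i + (θhat n x i - θhat n x i) ^ 2) / (2 * w' i))
      = ∑ i, (L' i - 1 / 2) := by
    refine Finset.sum_congr rfl fun i _ => ?_
    have : (w' i : ℝ) ≠ 0 := (NNReal.coe_pos.2 (hw'0 i)).ne'
    field_simp
    ring
  have s3 : ∑ i, (L' i - (w i + (μ i - θhat n x i) ^ 2) / (2 * w' i))
      = ∑ i, L' i - α / 2 * ∑ i, V i i * (n * w i) - α / 2 * ∑ i, V i i * (m - d) i ^ 2 := by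
    rw [Finset.mul_sum, Finset.mul_sum, ← Finset.sum_sub_distrib, ← Finset.sum_sub_distrib]
    refine Finset.sum_congr rfl fun i _ => ?_
    rw [hdiff, hw']
    have := (hVi i).ne'
    field_simp
    ring
  have s4 : ∑ i, V i i * (n * (w' i : ℝ)) = ∑ i : Fin p, 1 / α := by
    refine Finset.sum_congr rfl fun i _ => ?_
    rw [hw']
    have := (hVi i).ne'
    field_simp
  rw [s1] at hkl ⊢
  rw [s2, s4] at hkl'
  rw [s3]
  simp only [Finset.sum_add_distrib, Finset.sum_sub_distrib, ← Finset.mul_sum, Finset.sum_const,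
    Finset.card_univ, Fintype.card_fin, nsmul_eq_mul] at hG hkl hkl' ⊢
  have e : α / 2 * (p * (1 / α)) = p * (1 / 2) := by field_simp
  rw [mul_add, e] at hkl'
  set E := ∑ i, L i
  set E' := ∑ i, L' i
  set S := ∑ i, V i i * (n * (w i : ℝ))
  set D := ∑ i, V i i * (m - d) i ^ 2
  set Q := (m - d) ⬝ᵥ V *ᵥ (m - d)
  have k1 := (abs_le.1 hkl).1
  have k2 := (abs_le.1 hkl').2
  -- The excess of the limiting objective over its value at the target; completing the square merges
  -- the linear and quadratic terms into `Q`.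
  have key : (E - E' - p * (1 / 2) + α / 2 * S) + α / 2 * Q ≤ 2 * (α + 1) * η := by
    rw [hq]
    linarith
  -- The variance part is nonnegative, so `1 ≤ C` lets a single factor `C` serve for both parts.
  have hG' : E - E' - p * (1 / 2) + α / 2 * S
      ≤ C * (E - E' - p * (1 / 2) + α / 2 * S) := le_mul_of_one_le_left hG hC
  have hC0 : 0 ≤ C := by linarith
  have k3 := mul_le_mul_of_nonneg_left key hC0
  have k4 := mul_le_mul_of_nonneg_left hu (by positivity : 0 ≤ α / 2)
  linarith

end Model

end

/-! ### Boundedness in probability -/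

section

variable {p : ℕ} {𝒳 : ℕ → Type*} [∀ n, MeasurableSpace (𝒳 n)]

theorem exists_nat_measure_le_norm_lt {E : Type*} [NormedAddCommGroup E] [MeasurableSpace E]
    [OpensMeasurableSpace E] (Q : Measure E) [IsFiniteMeasure Q] {ε : ℝ≥0∞} (hε : 0 < ε) :
    ∃ k : ℕ, Q {y | (k : ℝ) ≤ ‖y‖} < ε := by
  have h := tendsto_measure_iInter_atTop (μ := Q) (s := fun k : ℕ => {y : E | (k : ℝ) ≤ ‖y‖})
    (fun k => (isClosed_le continuous_const continuous_norm).measurableSet.nullMeasurableSet)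
    (fun i j hij y (hy : (j : ℝ) ≤ ‖y‖) => (Nat.cast_le.2 hij).trans hy)
    ⟨0, measure_ne_top _ _⟩
  have h0 : ⋂ k : ℕ, {y : E | (k : ℝ) ≤ ‖y‖} = ∅ := by
    ext y
    simpa using exists_nat_gt ‖y‖
  rw [h0, measure_empty] at h
  exact (h.eventually_lt_const hε).exists

namespace Model

variable {M : Model p 𝒳} {θstar : Fin p → ℝ} {θhat : ∀ n, 𝒳 n → Fin p → ℝ}

/-- Convergence in distribution implies tightness: the portmanteau theorem on the closed sets `k ≤
‖y‖` controls all large `n`. Boundedness is required for every `n`, so the finitely many remaining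
laws are handled one by one. -/
theorem AsymptoticallyNormal.boundedInProb (h : M.AsymptoticallyNormal θstar θhat)
    (hm : ∀ n, Measurable (θhat n)) :
    M.BoundedInProb fun n x => √(n : ℝ) • (θhat n x - θstar) := by
  intro ε hε
  obtain ⟨G, hG, hT⟩ := h
  set Y : ∀ n : ℕ, 𝒳 n → Fin p → ℝ := fun n x => √(n : ℝ) • (θhat n x - θstar)
  have hY : ∀ n, Measurable (Y n) := fun n => ((hm n).sub_const _).const_smul (√(n : ℝ))
  have hF : ∀ k : ℕ, IsClosed {y : Fin p → ℝ | (k : ℝ) ≤ ‖y‖} := fun k =>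
    isClosed_le continuous_const continuous_norm
  have hε' : 0 < ENNReal.ofReal ε := ENNReal.ofReal_pos.2 hε
  obtain ⟨k, hk⟩ := exists_nat_measure_le_norm_lt (G.map id) hε'
  have hlim := ProbabilityMeasure.limsup_measure_closed_le_of_tendsto hT.tendsto (hF k)
  obtain ⟨N, hN⟩ := eventually_atTop.1 (eventually_lt_of_limsup_lt (hlim.trans_lt hk))
  choose K hK using fun n => exists_nat_measure_le_norm_lt ((M.P n).map (Y n)) hε'
  set C : ℕ := k + ∑ n ∈ Finset.range N, K n + 1
  refine ⟨C, by positivity, fun n => ?_⟩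
  have hsmall : (M.P n).map (Y n) {y | (C : ℝ) ≤ ‖y‖} < ENNReal.ofReal ε := by
    rcases lt_or_ge n N with hn | hn
    · refine (measure_mono fun y (hy : (C : ℝ) ≤ ‖y‖) => ?_).trans_lt (hK n)
      have : K n ≤ C := by
        have := Finset.single_le_sum (f := K) (fun _ _ => Nat.zero_le _) (Finset.mem_range.2 hn)
        omega
      exact (Nat.cast_le.2 this).trans hy
    · refine (measure_mono fun y (hy : (C : ℝ) ≤ ‖y‖) => ?_).trans_lt (hN n hn)
      exact (Nat.cast_le.2 (by omega : k ≤ C)).trans hy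
  rw [Measure.map_apply (hY n) (hF C).measurableSet] at hsmall
  have hc : {x | ‖Y n x‖ < C} = (Y n ⁻¹' {y | (C : ℝ) ≤ ‖y‖})ᶜ := by
    ext x; simp
  change 1 - ε ≤ (M.P n).real {x | ‖Y n x‖ < C}
  rw [hc, probReal_compl_eq_one_sub (hY n (hF C).measurableSet)]
  have := (ENNReal.lt_ofReal_iff_toReal_lt (measure_ne_top _ _)).1 hsmall
  rw [measureReal_def]
  linarith

theorem BoundedInProb.mono {E F : Type*} [Norm E] [Norm F] {Y : ∀ n, 𝒳 n → E}
    {Y' : ∀ n, 𝒳 n → F} (h : M.BoundedInProb Y) {B : ℝ}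
    (hle : ∀ n x, ‖Y' n x‖ ≤ max ‖Y n x‖ B) : M.BoundedInProb Y' := by
  intro ε hε
  obtain ⟨C, hC, h⟩ := h ε hε
  refine ⟨max C (B + 1), lt_max_of_lt_left hC, fun n => (h n).trans ?_⟩
  refine measureReal_mono fun x (hx : ‖Y n x‖ < C) => ?_
  exact (hle n x).trans_lt (max_lt (hx.trans_le (le_max_left _ _))
    ((lt_add_one B).trans_le (le_max_right _ _)))

end Model

end

end AlphaVB

/-! ### Convergence in probability -/

theorem theorem2 {p : ℕ} {𝒳 : ℕ → Type*} [∀ n, MeasurableSpace (𝒳 n)]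
    (M : AlphaVB.Model p 𝒳) (α : ℝ) (hα : 0 < α)
    -- the pseudo-true parameter and the maximum likelihood estimator
    (θstar : Fin p → ℝ) (hθstar : θstar ∈ interior M.Θ)
    (θhat : ∀ n, 𝒳 n → Fin p → ℝ) (hθhat_meas : ∀ n, Measurable (θhat n))
    (hθhat : ∀ᶠ n in atTop, ∀ᵐ x ∂M.P n, M.IsUniqueMLE n x (θhat n x))
    (hnormal : M.AsymptoticallyNormal θstar θhat)
    -- the `α`-posterior is well defined
    (hposterior : ∀ᶠ n in atTop, ∀ᵐ x ∂M.P n,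
      M.evidence α n x ≠ 0 ∧ M.evidence α n x ≠ ∞)
    -- the two regularity assumptions
    (V : Matrix (Fin p) (Fin p) ℝ) (hV : V.PosDef)
    (hLAN : M.StochasticLAN θstar θhat V)
    (hreg : M.GaussianRegularity θstar θhat V)
    -- the Gaussian mean-field variational approximation of the `α`-posterior
    (μtilde : ∀ n, 𝒳 n → Fin p → ℝ) (vtilde : ∀ n, 𝒳 n → Fin p → ℝ≥0)
    (hμtilde_meas : ∀ n, Measurable (μtilde n)) (hvtilde_meas : ∀ n, Measurable (vtilde n))
    (hvar : ∀ᶠ n in atTop, ∀ᵐ x ∂M.P n,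
      M.IsGaussianMFApprox α n x (μtilde n x) (vtilde n x))
    (hbdd : M.RescaledBounded θstar μtilde vtilde) :
    ∀ ε : ℝ, 0 < ε →
      Tendsto (fun n => M.P n {x | ε <
        AlphaVB.tvDist (AlphaVB.gaussianMF (μtilde n x) (vtilde n x))
          (AlphaVB.gaussianMF (θhat n x)
            (fun i => Real.toNNReal ((V i i)⁻¹ / (α * (n : ℝ)))))})
        atTop (𝓝 0) := by
  classical
  intro ε hε
  obtain ⟨C, hC, hVC⟩ := AlphaVB.exists_sum_diag_le_of_posDef hV
  have hVi : ∀ i, 0 < V i i := fun i => hV.diag_pos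
  obtain ⟨hπ, hreg⟩ := hreg
  -- the variances of the limit, made positive also at sample size zero
  set w : ℕ → Fin p → ℝ≥0 := fun n i =>
    if n = 0 then 1 else Real.toNNReal ((V i i)⁻¹ / (α * (n : ℝ))) with hwdef
  have hw0 : ∀ n i, 0 < w n i := fun n i => by
    by_cases hn : n = 0
    · simp [hwdef, hn]
    · have := hVi i
      have : (0 : ℝ) < n := by positivity
      simp only [hwdef, hn, if_false, Real.toNNReal_pos]
      positivity
  have hwn : ∀ (n : ℕ) (i), ‖(n : ℝ) * (w n i : ℝ)‖ ≤ (V i i)⁻¹ / α := fun n i => by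
    have := hVi i
    rw [Real.norm_of_nonneg (by positivity)]
    by_cases hn : n = 0
    · simp only [hn, Nat.cast_zero, zero_mul]; positivity
    · have : (0 : ℝ) < n := by positivity
      simp only [hwdef, hn, if_false]
      rw [Real.coe_toNNReal _ (by positivity)]
      apply le_of_eq
      field_simp
  have hbhat : M.RescaledBounded θstar θhat fun n _ => w n := by
    refine (hnormal.boundedInProb hθhat_meas).mono (B := ∑ i, (V i i)⁻¹ / α) fun n x => ?_
    have hnn : ∀ i, 0 ≤ (V i i)⁻¹ / α := fun i => by have := hVi i; positivity
    refine max_le_max le_rfl ((pi_norm_le_iff_of_nonneg (Finset.sum_nonneg fun i _ => hnn i)).2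
      fun i => (hwn n i).trans ?_)
    exact Finset.single_le_sum (f := fun i => (V i i)⁻¹ / α) (fun i _ => hnn i) (Finset.mem_univ i)
  -- the variational variances, made positive
  set v : ∀ n, 𝒳 n → Fin p → ℝ≥0 := fun n x =>
    if ∀ i, 0 < vtilde n x i then vtilde n x else fun _ => ((n : ℝ≥0) + 1)⁻¹ with hvdef
  have hv0 : ∀ n x i, 0 < v n x i := fun n x i => by
    by_cases h : ∀ i, 0 < vtilde n x i
    · simp only [hvdef, if_pos h]; exact h i
    · simp only [hvdef, if_neg h]; positivity
  have hvm : ∀ n, Measurable (v n) := fun n => by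
    refine Measurable.ite ?_ (hvtilde_meas n) measurable_const
    rw [Set.ofPred_forall]
    exact MeasurableSet.iInter fun i =>
      measurableSet_lt measurable_const ((measurable_pi_apply i).comp (hvtilde_meas n))
  have hbtilde : M.RescaledBounded θstar μtilde v := by
    -- The substitute variances satisfy `n * (n + 1)⁻¹ ≤ 1`.
    refine hbdd.mono (B := 1) fun n x => ?_
    by_cases h : ∀ i, 0 < vtilde n x i
    · simp only [hvdef, if_pos h]; exact le_max_left _ _
    · simp only [hvdef, if_neg h]
      refine max_le_max (le_max_left _ _)
        ((pi_norm_le_iff_of_nonneg zero_le_one).2 fun i => ?_)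
      rw [Real.norm_of_nonneg (by positivity)]
      push_cast
      rw [← div_eq_mul_inv, div_le_one (by positivity)]
      linarith
  -- Chosen so that `C * (2 * (α + 1) * η) = ε ^ 2`; with `δ = ε / 2` the final bound is then `ε / 2
  -- + ε / 2`.
  set η : ℝ := ε ^ 2 / (2 * C * (α + 1)) with hη
  have hC0 : 0 < C := by linarith
  obtain ⟨t1, t2⟩ := hreg θhat (fun n _ => w n) hθhat_meas (fun _ => measurable_const)
    (fun n _ i => hw0 n i) hbhat η (by positivity)
  obtain ⟨t3, t4⟩ := hreg μtilde v hμtilde_meas hvm hv0 hbtilde η (by positivity)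
  have tsum := ((t1.add t2).add t3).add t4
  simp only [add_zero] at tsum
  refine tendsto_of_tendsto_of_tendsto_of_le_of_le' tendsto_const_nhds tsum
    (Eventually.of_forall fun _ => zero_le) ?_
  filter_upwards [hposterior, hvar, eventually_ne_atTop 0] with n hpost hmin hn
  set A₁ : Set (𝒳 n) := {x | ¬ M.PriorRegularAt θstar n (θhat n x) (w n) η}
  set A₂ : Set (𝒳 n) := {x | ¬ M.ResidualRegularAt θstar θhat V n x (θhat n x) (w n) η}
  set A₃ : Set (𝒳 n) := {x | ¬ M.PriorRegularAt θstar n (μtilde n x) (v n x) η}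
  set A₄ : Set (𝒳 n) := {x | ¬ M.ResidualRegularAt θstar θhat V n x (μtilde n x) (v n x) η}
  have hsub : M.P n {x | ε < AlphaVB.tvDist (AlphaVB.gaussianMF (μtilde n x) (vtilde n x))
      (AlphaVB.gaussianMF (θhat n x) (fun i => Real.toNNReal ((V i i)⁻¹ / (α * (n : ℝ)))))}
      ≤ M.P n (A₁ ∪ A₂ ∪ A₃ ∪ A₄) := by
    -- Only a.e. inclusion and subadditivity are used, so none of these sets has to be measurable.
    refine measure_mono_ae ?_
    filter_upwards [hpost, hmin] with x hZ hx htv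
    by_contra hA
    change ¬ (x ∈ A₁ ∪ A₂ ∪ A₃ ∪ A₄) at hA
    simp only [Set.mem_union, not_or, A₁, A₂, A₃, A₄, Set.mem_ofPred_eq, not_not] at hA
    obtain ⟨⟨⟨h1, h2⟩, h3⟩, h4⟩ := hA
    have hwe : (fun i => Real.toNNReal ((V i i)⁻¹ / (α * (n : ℝ)))) = w n := by
      ext i; simp [hwdef, hn]
    have hve : (∀ i, 0 < vtilde n x i) → v n x = vtilde n x := fun h => if_pos h
    have hwr : ∀ i, (w n i : ℝ) = (V i i)⁻¹ / (α * n) := fun i => by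
      have := hVi i
      rw [← hwe, Real.coe_toNNReal _ (by positivity)]
    have hfin := AlphaVB.Model.tvDist_le_of_isGaussianMFApprox hα hV hC hVC hn hZ.1 hZ.2 hπ hwr hx
      h1 h2 (fun h => hve h ▸ h3) (fun h => hve h ▸ h4) (δ := ε / 2) (by positivity)
    have e : C * (2 * (α + 1) * η) / (4 * (ε / 2)) + ε / 2 = ε := by
      rw [hη]; field_simp; ring
    rw [e, ← hwe] at hfin
    exact absurd htv (not_lt.2 hfin)
  exact hsub.trans ((measure_union_le _ _).trans (add_le_add ((measure_union_le _ _).trans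
    (add_le_add (measure_union_le _ _) le_rfl)) le_rfl))
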